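/- **Definitions.** A $\beta$-set is a finite subset of $\mathbb{N}_0=\{0,1,2,\dots\}$. If $X=\{a_1>a_2>\dots>a_t\}$ is a $\beta$-set, $p(X)$ denotes the partition whose parts are the non-zero numbers among $a_i-(t-i)$, $1\le i\le t$; for a partition $\kappa$ with at most $r$ parts there is exactly one $\beta$-set $Y$ with $|Y|=r$ and $p(Y)=\kappa$. For $s\in\mathbb{N}_0$ put $[s]=\{0,1,\dots,s-1\}$. For an integer $d\ge 1$, a $d$-symbol is a $d$-tuple $S=(X_0,\dots,X_{d-1})$ of $\beta$-sets. The map $s_d$, which sends a $\beta$-set $X$ to the $d$-symbol whose $j$-th entry is $\{k\in\mathbb{N}_0 : j+kd\in X\}$ ($j\in[d]$), is a bijection from $\beta$-sets to $d$-symbols. The balanced quotient of a $d$-symbol $S$ is the $d$-symbol $Q(S)=(Y_0,\dots,Y_{d-1})$ in which $Y_i$ is the $\beta$-set with $p(Y_i)=p(X_i)$ and $|Y_i|=r$, where $r$ is the maximal number of parts of the partitions $p(X_0),\dots,p(X_{d-1})$. The core of $S$ is $C(S)=([x_0],\dots,[x_{d-1}])$, where $x_i=|X_i|$. For an integer $\ell\ge1$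 let $S_{*\ell}=s_{d\ell}(s_d^{-1}(S))$, a $d\ell$-symbol. The balanced $\ell$-quotient of $S$ is the $d\ell$-symbol $Q_\ell(S)=Q(S_{*\ell})$, and the $\ell$-core of $S$ is the $d$-symbol $C_{(\ell)}(S)=s_d\bigl(s_{d\ell}^{-1}(C(S_{*\ell}))\bigr)$. A hook in a $d$-symbol $S$ is a quadruple $(a,b,i,j)$ with $a,b\in\mathbb{N}_0$, $i,j\in[d]$, $a\ge b$, $a\in X_i$, $b\notin X_j$, and $i>j$ if $a=b$ (the hook is then called short). $H(S)$ is the finite set of hooks in $S$. For $\delta=(c_0,\dots,c_{d-1};k)$ with real entries and $k\ge0$, the $\delta$-length of $(a,b,i,j)$ is $h^\delta(a,b,i,j)=k(a-b)+c_i-c_j$, and $\mathcal{H}^\delta(S)$ is the multiset of all $h^\delta(z)$, $z\in H(S)$. The multiset of hook lengths of $S$ is $\mathcal{H}(S)=\mathcal{H}^{(0,\dots,0;1)}(S)$, i.e. the multiset of all $a-b$, $(a,b,i,j)\in H(S)$, short hooks of length $0$ included. Finally, for a $d$-symbol $S=(X_0,\dots,X_{d-1})$ and $\ell\ge1$, let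 $\delta_{\ell,S}=(c_0,\dots,c_{d\ell-1};\ell)$, where for $i\in[d]$ and $s\in[\ell]$ $$c_{sd+i}=s+x_{i,s}\,\ell,\qquad x_{i,s}=|\{a\in X_i : a\equiv s \pmod{\ell}\}|.$$ **Theorem.** Let $d,\ell\ge1$ be integers and let $S$ be a $d$-symbol. Let $C=C_{(\ell)}(S)$ be the $\ell$-core of $S$ and let $Q=Q_\ell(S)$ be the balanced $\ell$-quotient of $S$. Then there is an equality of multisets $$\mathcal{H}(S)=\operatorname{abs}\bigl(\mathcal{H}^{\delta_{\ell,S}}(Q)\bigr)\cup\mathcal{H}(C),$$ where $\operatorname{abs}(\mathcal{H}^{\delta_{\ell,S}}(Q))$ is the multiset of all $|h^{\delta_{\ell,S}}(z)|$, $z\in H(Q)$, and the union adds multiplicities. -/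

import Mathlib

namespace HookSymbols

/-- A `β`-set is a finite set of nonnegative integers. -/
abbrev BetaSet : Type := Finset ℕ

/-- A `d`-symbol is a `d`-tuple of `β`-sets. -/
abbrev DSymbol (d : ℕ) : Type := Fin d → BetaSet

/-- Integer partitions, of arbitrary size. -/
abbrev IntPartition : Type := Σ n : ℕ, Nat.Partition n

/-- The partition `p(X)`. If `X = {a₁ > ⋯ > a_t}`, its parts are the nonzero numbers among
`aᵢ - (t - i)`; here `t - i` is the number of elements of `X` below `aᵢ`, so that the subtraction
does not truncate, and `Nat.Partition.ofMultiset` drops the zeros. -/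
def toPartition (X : BetaSet) : IntPartition :=
  ⟨_, Nat.Partition.ofMultiset (X.val.map fun a => a - (X.filter (· < a)).card)⟩

/-- The number of parts of a partition. -/
def IntPartition.length (κ : IntPartition) : ℕ := κ.2.parts.card

/-- The `i`-th largest part of a partition, counted from `0`; it is `0` beyond the last part. -/
def IntPartition.part (κ : IntPartition) (i : ℕ) : ℕ :=
  (κ.2.parts.sort (· ≥ ·)).getD i 0

/-- The `β`-set of cardinality `r` of a partition with at most `r` parts: the set of all
`κᵢ + (r - i)`, `i = 1, …, r`. -/
def betaSet (r : ℕ) (κ : IntPartition) : BetaSet :=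
  (Finset.range r).image fun i => κ.part i + (r - 1 - i)

/-- The balanced `d`-symbol `t_d(κ₀, …, κ_{d-1})`: the `β`-sets of the `κᵢ` whose common
cardinality is the maximal number of parts of the `κᵢ`. -/
def balancedSymbol {d : ℕ} (κ : Fin d → IntPartition) : DSymbol d :=
  fun i => betaSet (Finset.univ.sup fun m => (κ m).length) (κ i)

theorem residueClass_injective {d : ℕ} [NeZero d] (j : Fin d) :
    Function.Injective fun k : ℕ => (j : ℕ) + k * d :=
  fun _ _ h => Nat.eq_of_mul_eq_mul_right (NeZero.pos d) (Nat.add_left_cancel h)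

/-- The bijection `s_d` from `β`-sets to `d`-symbols: the `j`-th component of `s_d(X)` is
`{k | j + k d ∈ X}`. -/
noncomputable def symbolEquiv (d : ℕ) [NeZero d] : BetaSet ≃ DSymbol d where
  toFun X j := X.preimage (fun k => (j : ℕ) + k * d) (residueClass_injective j).injOn
  invFun S := Finset.univ.biUnion fun j => (S j).image fun k => (j : ℕ) + k * d
  left_inv X := by
    ext n
    simp only [Finset.mem_biUnion, Finset.mem_univ, true_and, Finset.mem_image,
      Finset.mem_preimage]
    constructor
    · rintro ⟨j, k, h, rfl⟩
      exact h
    · intro h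
      refine ⟨⟨n % d, Nat.mod_lt _ (NeZero.pos d)⟩, n / d, ?_, ?_⟩
      · simpa [Nat.mod_add_div'] using h
      · simp [Nat.mod_add_div']
  right_inv S := by
    funext j
    ext k
    simp only [Finset.mem_biUnion, Finset.mem_univ, true_and, Finset.mem_image,
      Finset.mem_preimage]
    constructor
    · rintro ⟨i, m, h, e⟩
      have hi : i = j := by
        have := congrArg (· % d) e
        simp only [Nat.add_mul_mod_self_right, Nat.mod_eq_of_lt i.2, Nat.mod_eq_of_lt j.2] at this
        exact Fin.ext this
      subst hi
      have hm : m = k := Nat.eq_of_mul_eq_mul_right (NeZero.pos d) (Nat.add_left_cancel e)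
      exact hm ▸ h
    · intro h
      exact ⟨j, k, h, rfl⟩

/-- The balanced quotient `Q(S) = t_d(p(X₀), …, p(X_{d-1}))`. -/
def balancedQuotient {d : ℕ} (S : DSymbol d) : DSymbol d :=
  balancedSymbol fun i => toPartition (S i)

/-- The core `C(S) = ([x₀], …, [x_{d-1}])`, where `xᵢ = |Xᵢ|` and `[x] = {0, …, x - 1}`. -/
def core {d : ℕ} (S : DSymbol d) : DSymbol d :=
  fun i => Finset.range (S i).card

/-- The splitting `S_{*ℓ} = s_{dℓ}(s_d⁻¹(S))` of a `d`-symbol into a `dℓ`-symbol. -/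
noncomputable def splitSymbol {d : ℕ} [NeZero d] (ℓ : ℕ) [NeZero ℓ] (S : DSymbol d) :
    DSymbol (d * ℓ) :=
  symbolEquiv (d * ℓ) ((symbolEquiv d).symm S)

/-- The balanced `ℓ`-quotient `Q_ℓ(S) = Q(S_{*ℓ})`, a `dℓ`-symbol. -/
noncomputable def lQuotient {d : ℕ} [NeZero d] (ℓ : ℕ) [NeZero ℓ] (S : DSymbol d) :
    DSymbol (d * ℓ) :=
  balancedQuotient (splitSymbol ℓ S)

/-- The `ℓ`-core `C_(ℓ)(S) = s_d(s_{dℓ}⁻¹(C(S_{*ℓ})))`, a `d`-symbol. -/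
noncomputable def lCore {d : ℕ} [NeZero d] (ℓ : ℕ) [NeZero ℓ] (S : DSymbol d) : DSymbol d :=
  symbolEquiv d ((symbolEquiv (d * ℓ)).symm (core (splitSymbol ℓ S)))

/-- The set `H(S)` of hooks of a `d`-symbol: the quadruples `(a, b, i, j)` with `a ≥ b`, `a ∈ Xᵢ`,
`b ∉ Xⱼ`, and `i > j` if `a = b` (short hooks). -/
def hookSet {d : ℕ} (S : DSymbol d) : Set (ℕ × ℕ × Fin d × Fin d) :=
  {z | match z with
    | (a, b, i, j) => b ≤ a ∧ a ∈ S i ∧ b ∉ S j ∧ (a = b → j < i)}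

theorem hookSet_finite {d : ℕ} (S : DSymbol d) : (hookSet S).Finite := by
  set M := Finset.range ((Finset.univ.biUnion S).sup id + 1) with hM
  refine (M ×ˢ M ×ˢ (Finset.univ : Finset (Fin d)) ×ˢ
    (Finset.univ : Finset (Fin d))).finite_toSet.subset ?_
  rintro ⟨a, b, i, j⟩ ⟨hba, ha, -, -⟩
  have h : a ≤ (Finset.univ.biUnion S).sup id :=
    Finset.le_sup (f := id) (Finset.mem_biUnion.2 ⟨i, Finset.mem_univ _, ha⟩)
  simp only [Finset.coe_product, Set.mem_prod, Finset.mem_coe, hM, Finset.mem_range,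
    Finset.mem_univ, and_true]
  omega

/-- The finite set of hooks of a `d`-symbol. -/
noncomputable def hooks {d : ℕ} (S : DSymbol d) : Finset (ℕ × ℕ × Fin d × Fin d) :=
  (hookSet_finite S).toFinset

/-- A `d`-hook data tuple `δ = (c₀, …, c_{d-1}; k)` of real numbers with `k ≥ 0`. -/
structure HookData (d : ℕ) where
  c : Fin d → ℝ
  k : ℝ
  k_nonneg : 0 ≤ k

/-- The `δ`-length `k (a - b) + cᵢ - cⱼ` of `(a, b, i, j)`. -/
def HookData.hookLength {d : ℕ} (δ : HookData d) : ℕ × ℕ × Fin d × Fin d → ℝ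
  | (a, b, i, j) => δ.k * ((a : ℝ) - (b : ℝ)) + δ.c i - δ.c j

/-- The multiset of the `δ`-lengths of all hooks of `S`. -/
noncomputable def HookData.hookLengths {d : ℕ} (δ : HookData d) (S : DSymbol d) : Multiset ℝ :=
  (hooks S).val.map δ.hookLength

/-- The minimal `d`-hook data tuple `(0, …, 0; 1)`. -/
def minimalData (d : ℕ) : HookData d where
  c := fun _ => 0
  k := 1
  k_nonneg := zero_le_one

/-- The multiset `ℋ(S)` of the hook lengths `a - b` of `S`, short hooks of length `0` included. -/
noncomputable def hookLengths {d : ℕ} (S : DSymbol d) : Multiset ℝ :=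
  (minimalData d).hookLengths S

/-- The number of elements of a `β`-set which are congruent to `s` modulo `ℓ`. -/
def residueCount (ℓ : ℕ) (X : BetaSet) (s : ℕ) : ℕ :=
  (X.filter fun a => a ≡ s [MOD ℓ]).card

/-- The `dℓ`-hook data tuple `δ_{ℓ,S}`: its entry at `s d + i` (with `i ∈ [d]`, `s ∈ [ℓ]`) is
`s + x_{i,s} ℓ`, where `x_{i,s}` is the number of elements of `Xᵢ` congruent to `s` modulo `ℓ`,
and `k = ℓ`. -/
noncomputable def lData {d : ℕ} [NeZero d] (ℓ : ℕ) (S : DSymbol d) : HookData (d * ℓ) where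
  c := fun m =>
    ((m : ℕ) / d : ℕ) +
      (residueCount ℓ (S ⟨(m : ℕ) % d, Nat.mod_lt _ (NeZero.pos d)⟩) ((m : ℕ) / d) : ℝ) * (ℓ : ℝ)
  k := ℓ
  k_nonneg := Nat.cast_nonneg ℓ

end HookSymbols

/-! Since `S` and `T = splitSymbol ℓ S` encode the same β-set, `splitData` gives `T` the hook
lengths of `S` (`hookLengths_eq_splitSymbol`). It remains to compare `T` with its balanced quotient
and its core. Fix a value `v` and let `g` indicate absolute length `v`. For components `A`, `B`,
`pairSum` counts hooks in both directions. Shifting `A`, with `g` translated accordingly, changes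
this count by an amount depending only on `|A|` and `|B|`, so by the same amount for `T` and for its
core. Shift all components to a common size `R`: the core becomes `[R]` throughout, where every pair
sum vanishes, while `T` becomes a simultaneous shift of its quotient, which pair sums do not see.
The translation of `g` turns `δ` into the adjusted data `δ'`. Hence `pairSum` for `T` is the sum of
those for quotient and core. -/

namespace HookSymbols

/-! ### Shifts of β-sets. -/

/-- The shift `{0} ∪ (X + 1)` of a `β`-set, which has the same partition as `X`. -/
def shift (X : BetaSet) : BetaSet :=
  insert 0 (X.map (addRightEmbedding 1))

theorem zero_mem_shift (X : BetaSet) : 0 ∈ shift X := by simp [shift]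

theorem succ_mem_shift {X : BetaSet} {n : ℕ} : n + 1 ∈ shift X ↔ n ∈ X := by simp [shift]

theorem sum_shift {M : Type*} [AddCommMonoid M] (X : BetaSet) (f : ℕ → M) :
    ∑ a ∈ shift X, f a = f 0 + ∑ a ∈ X, f (a + 1) := by
  rw [shift, Finset.sum_insert (by simp), Finset.sum_map]
  rfl

theorem card_shift (X : BetaSet) : (shift X).card = X.card + 1 := by
  rw [shift, Finset.card_insert_of_notMem (by simp), Finset.card_map]

theorem card_shift_iterate (X : BetaSet) (p : ℕ) : (shift^[p] X).card = X.card + p := by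
  induction p with
  | zero => rfl
  | succ p ih => rw [Function.iterate_succ_apply', card_shift, ih, add_assoc]

theorem shift_range (n : ℕ) : shift (Finset.range n) = Finset.range (n + 1) := by
  ext m
  cases m with
  | zero => simp [zero_mem_shift]
  | succ m => simp [succ_mem_shift]

theorem shift_iterate_range (n p : ℕ) :
    shift^[p] (Finset.range n) = Finset.range (n + p) := by
  induction p with
  | zero => rfl
  | succ p ih => rw [Function.iterate_succ_apply', ih, shift_range, add_assoc]

/-! ### Pair sums and their behaviour under shifts. -/

/-- The sum of `g (a - b)` over all `a ∈ A`, `b ∉ B` with `b < a + e`. -/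
def rowSum (A B : BetaSet) (e : ℕ) (g : ℤ → ℤ) : ℤ :=
  ∑ a ∈ A, ∑ b ∈ Finset.range (a + e), if b ∈ B then 0 else g ((a : ℤ) - b)

theorem rowSum_shift_shift (A B : BetaSet) {e : ℕ} (he : e ≤ 1) (g : ℤ → ℤ) :
    rowSum (shift A) (shift B) e g = rowSum A B e g := by
  unfold rowSum
  rw [sum_shift]
  have h0 : ∑ b ∈ Finset.range (0 + e),
      (if b ∈ shift B then 0 else g (((0 : ℕ) : ℤ) - b)) = 0 := by
    apply Finset.sum_eq_zero
    intro b hb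
    obtain rfl : b = 0 := by have := Finset.mem_range.1 hb; omega
    rw [if_pos (zero_mem_shift B)]
  rw [h0, zero_add]
  refine Finset.sum_congr rfl fun a _ => ?_
  rw [add_right_comm, Finset.sum_range_succ', if_pos (zero_mem_shift B), add_zero]
  refine Finset.sum_congr rfl fun b _ => ?_
  simp only [succ_mem_shift]
  push_cast
  rw [add_sub_add_right_eq_sub]

/-- The extra column `b = a` lies in `A`, so it contributes nothing. -/
theorem rowSum_self (A : BetaSet) (g : ℤ → ℤ) : rowSum A A 1 g = rowSum A A 0 g := by
  refine Finset.sum_congr rfl fun a ha => ?_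
  rw [Finset.sum_range_succ, if_pos ha, add_zero, add_zero]

theorem rowSum_range (n e : ℕ) (he : e ≤ 1) (g : ℤ → ℤ) :
    rowSum (Finset.range n) (Finset.range n) e g = 0 := by
  refine Finset.sum_eq_zero fun a ha => Finset.sum_eq_zero fun b hb => if_pos ?_
  rw [Finset.mem_range] at *
  omega

/-- The sum of `g (a - b)` over the pairs `a ∈ A`, `b ∉ B` with `b < a + e`, and over the pairs
`a ∉ A`, `b ∈ B` with `a < b + (1 - e)`. -/
def pairSum (A B : BetaSet) (e : ℕ) (g : ℤ → ℤ) : ℤ :=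
  rowSum A B e g + rowSum B A (1 - e) fun t => g (-t)

theorem pairSum_swap (A B : BetaSet) {e : ℕ} (he : e ≤ 1) (g : ℤ → ℤ) :
    pairSum B A (1 - e) (fun t => g (-t)) = pairSum A B e g := by
  simp only [pairSum, neg_neg, Nat.sub_sub_self he]
  exact add_comm _ _

theorem sum_notMem_sub_sum_notMem (A B : BetaSet) (z : ℤ) :
    (∑ a ∈ A, if a ∈ B then 0 else z) - (∑ b ∈ B, if b ∈ A then 0 else z) =
      z * (A.card - B.card) := by
  have h : ∀ A B : BetaSet, (∑ a ∈ A, if a ∈ B then 0 else z) =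
      z * A.card - z * (A ∩ B).card := by
    intro A B
    have := Finset.sum_ite_mem A B (fun _ => z)
    have h2 : (∑ a ∈ A, if a ∈ B then 0 else z) + (∑ a ∈ A, if a ∈ B then z else 0) =
        ∑ a ∈ A, z := by
      rw [← Finset.sum_add_distrib]
      refine Finset.sum_congr rfl fun a _ => ?_
      split_ifs <;> simp
    rw [this] at h2
    simp only [Finset.sum_const, nsmul_eq_mul] at h2
    linarith
  rw [h A B, h B A, Finset.inter_comm B A]
  ring

/-- The row of `a + 1` has one more column, `b = a + e`, than the row of `a`; the row of the new
element `0` gives the last sum. -/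
theorem rowSum_shift_left (A B : BetaSet) (e : ℕ) (g : ℤ → ℤ) :
    rowSum (shift A) B e (fun t => g (t - 1)) = rowSum A B e g +
      ((∑ a ∈ A, if a + e ∈ B then 0 else g (-e)) +
        ∑ b ∈ Finset.range e, if b ∈ B then 0 else g (-1 - b)) := by
  unfold rowSum
  rw [sum_shift, ← add_assoc, ← Finset.sum_add_distrib, add_comm]
  congr 1
  · refine Finset.sum_congr rfl fun a _ => ?_
    rw [add_right_comm, Finset.sum_range_succ]
    congr 1
    · refine Finset.sum_congr rfl fun b _ => ?_
      congr 2; push_cast; ring_nf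
    · congr 2; push_cast; ring_nf
  · rw [zero_add]
    refine Finset.sum_congr rfl fun b _ => ?_
    congr 2; push_cast; ring_nf

theorem rowSum_shift_right_one (A B : BetaSet) (g : ℤ → ℤ) :
    rowSum B (shift A) 1 (fun t => g (t + 1)) =
      rowSum B A 1 g - ∑ b ∈ B, if b ∈ A then 0 else g 0 := by
  unfold rowSum
  rw [← Finset.sum_sub_distrib]
  refine Finset.sum_congr rfl fun b _ => ?_
  rw [Finset.sum_range_succ', if_pos (zero_mem_shift A), Finset.sum_range_succ, sub_self]
  simp only [succ_mem_shift, add_zero, add_sub_cancel_right]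
  refine Finset.sum_congr rfl fun a _ => ?_
  congr 2; push_cast; ring_nf

theorem rowSum_shift_right_zero (A B : BetaSet) (g : ℤ → ℤ) :
    rowSum B (shift A) 0 (fun t => g (t + 1)) =
      rowSum B A 0 g - ∑ b ∈ B, if b ∈ shift A then 0 else g 1 := by
  unfold rowSum
  rw [← Finset.sum_sub_distrib]
  refine Finset.sum_congr rfl fun b _ => ?_
  cases b with
  | zero => simp [zero_mem_shift]
  | succ b =>
    simp only [add_zero]
    rw [Finset.sum_range_succ', if_pos (zero_mem_shift A), Finset.sum_range_succ]
    simp only [succ_mem_shift, add_zero]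
    rw [show ((b + 1 : ℕ) : ℤ) - b = 1 by push_cast; ring, add_sub_cancel_right]
    refine Finset.sum_congr rfl fun a _ => ?_
    congr 2; push_cast; ring_nf

/-- The corrections from the two halves are multiples of `|A ∖ B|` and `|B ∖ A|` (with `shift A` for
`A` when `e = 1`). Only their difference enters, and it is the difference of the cardinalities. -/
theorem pairSum_shift_left (A B : BetaSet) {e : ℕ} (he : e ≤ 1) (g : ℤ → ℤ) :
    pairSum (shift A) B e (fun t => g (t - 1)) =
      pairSum A B e g + g (-e) * (A.card + e - B.card) := by
  have hg : (fun t : ℤ => g (-t - 1)) = fun t => g (-(t + 1)) := by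
    funext t; congr 1; ring
  unfold pairSum
  rw [hg, rowSum_shift_left]
  interval_cases e
  · rw [Nat.sub_zero, rowSum_shift_right_one A B fun u => g (-u)]
    have := sum_notMem_sub_sum_notMem A B (g 0)
    simp only [Finset.range_zero, Finset.sum_empty, Nat.cast_zero, neg_zero, add_zero] at *
    linarith
  · rw [Nat.sub_self, rowSum_shift_right_zero A B fun u => g (-u)]
    have := sum_notMem_sub_sum_notMem (shift A) B (g (-1))
    rw [sum_shift, card_shift] at this
    simp only [Finset.sum_range_one, Nat.cast_zero, sub_zero, Nat.cast_add, Nat.cast_one] at *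
    linarith

theorem pairSum_shift_right (A B : BetaSet) {e : ℕ} (he : e ≤ 1) (g : ℤ → ℤ) :
    pairSum A (shift B) e (fun t => g (t + 1)) =
      pairSum A B e g + g (1 - e) * (B.card + 1 - e - A.card) := by
  rw [← pairSum_swap A _ he, ← pairSum_swap A B he]
  have := pairSum_shift_left B A (Nat.sub_le 1 e) (fun t => g (-t))
  have hg : (fun t : ℤ => g (-(t - 1))) = fun t => g (-t + 1) := by
    funext t; congr 1; ring
  rw [hg] at this
  rw [this]
  push_cast [he]
  ring_nf

/-- Shifting changes a pair sum by an amount which depends only on cardinalities. -/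
theorem pairSum_shift_iterate {A A' B B' : BetaSet} (hA : A.card = A'.card)
    (hB : B.card = B'.card) {e : ℕ} (he : e ≤ 1) (g : ℤ → ℤ) (p q : ℕ) :
    pairSum (shift^[p] A) (shift^[q] B) e (fun t => g (t - p + q)) - pairSum A B e g =
      pairSum (shift^[p] A') (shift^[q] B') e (fun t => g (t - p + q)) - pairSum A' B' e g := by
  induction p with
  | zero =>
    induction q with
    | zero => simp
    | succ q ih =>
      have hg : (fun t : ℤ => g (t - (0 : ℕ) + (q + 1 : ℕ))) =
          fun t => g (t + 1 - (0 : ℕ) + q) := by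
        funext t; congr 1; push_cast; ring
      rw [hg, Function.iterate_succ_apply', Function.iterate_succ_apply',
        pairSum_shift_right _ _ he fun u => g (u - (0 : ℕ) + q),
        pairSum_shift_right _ _ he fun u => g (u - (0 : ℕ) + q)]
      simp only [card_shift_iterate, hA, hB]
      linarith
  | succ p ih =>
    have hg : (fun t : ℤ => g (t - (p + 1 : ℕ) + q)) =
        fun t => g (t - 1 - p + q) := by
      funext t; congr 1; push_cast; ring
    rw [hg, Function.iterate_succ_apply', Function.iterate_succ_apply',
      pairSum_shift_left _ _ he fun u => g (u - p + q),
      pairSum_shift_left _ _ he fun u => g (u - p + q)]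
    simp only [card_shift_iterate, hA, hB]
    linarith

theorem pairSum_shift_shift_iterate (A B : BetaSet) {e : ℕ} (he : e ≤ 1) (g : ℤ → ℤ) (p : ℕ) :
    pairSum (shift^[p] A) (shift^[p] B) e g = pairSum A B e g := by
  induction p with
  | zero => rfl
  | succ p ih =>
    rw [Function.iterate_succ_apply', Function.iterate_succ_apply', ← ih]
    simp only [pairSum, rowSum_shift_shift _ _ he, rowSum_shift_shift _ _ (Nat.sub_le 1 e)]

theorem pairSum_range (n : ℕ) {e : ℕ} (he : e ≤ 1) (g : ℤ → ℤ) :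
    pairSum (Finset.range n) (Finset.range n) e g = 0 := by
  rw [pairSum, rowSum_range _ _ he, rowSum_range _ _ (Nat.sub_le 1 e), add_zero]

/-! ### Recovering β-sets from their partitions. -/

theorem getD_filter_ne_zero {l : List ℕ} (hl : l.SortedGE) (i : ℕ) :
    (l.filter (· ≠ 0)).getD i 0 = l.getD i 0 := by
  induction l generalizing i with
  | nil => rfl
  | cons a l ih =>
    have hp := List.pairwise_cons.1 hl.pairwise
    by_cases ha : a = 0
    · subst ha
      have h0 : ∀ b ∈ (0 :: l), b = 0 := by
        intro b hb
        rcases List.mem_cons.1 hb with rfl | hb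
        · rfl
        · exact Nat.le_zero.1 (hp.1 b hb)
      have hf : (0 :: l).filter (· ≠ 0) = [] := by
        rw [List.filter_eq_nil_iff]
        intro b hb
        simpa using h0 b hb
      rw [hf]
      by_cases hi : i < (0 :: l).length
      · rw [List.getD_eq_getElem _ _ hi, h0 _ (List.getElem_mem hi), List.getD_nil]
      · rw [List.getD_eq_default _ _ (not_lt.1 hi), List.getD_nil]
    · rw [List.filter_cons_of_pos (by simpa using ha)]
      cases i with
      | zero => rfl
      | succ i => simpa using ih hp.2.sortedGE i

theorem IntPartition.part_eq_getD {κ : IntPartition} {l : List ℕ} (hl : l.SortedGE)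
    (h : κ.2.parts = (l : Multiset ℕ).filter (· ≠ 0)) (i : ℕ) : κ.part i = l.getD i 0 := by
  rw [IntPartition.part, h, ← getD_filter_ne_zero hl]
  congr 1
  apply List.Perm.eq_of_sortedGE
  · exact (Multiset.pairwise_sort _ _).sortedGE
  · exact (hl.pairwise.filter _).sortedGE
  · rw [← Multiset.coe_eq_coe, Multiset.sort_eq]
    rfl

theorem length_toPartition_le (X : BetaSet) : (toPartition X).length ≤ X.card := by
  have h : (toPartition X).length ≤ (X.val.map fun a => a - (X.filter (· < a)).card).card :=
    Multiset.card_le_card (Multiset.filter_le _ _)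
  rwa [Multiset.card_map] at h

/-- The additional part is zero and yields the element `0`; every other element rises by one. -/
theorem betaSet_succ {κ : IntPartition} {r : ℕ} (h : κ.length ≤ r) :
    betaSet (r + 1) κ = shift (betaSet r κ) := by
  have hr : κ.part r = 0 := by
    rw [IntPartition.part, List.getD_eq_default]
    rwa [Multiset.length_sort]
  rw [betaSet, Finset.range_add_one, Finset.image_insert, hr, shift, betaSet, Finset.map_eq_image,
    Finset.image_image]
  congr 1
  · omega
  · refine Finset.image_congr fun i hi => ?_
    have := Finset.mem_range.1 (Finset.mem_coe.1 hi)
    simp only [Function.comp_apply, addRightEmbedding_apply]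
    omega

theorem betaSet_add {κ : IntPartition} {r : ℕ} (h : κ.length ≤ r) (p : ℕ) :
    betaSet (r + p) κ = shift^[p] (betaSet r κ) := by
  induction p with
  | zero => rfl
  | succ p ih => rw [Function.iterate_succ_apply', ← ih, ← betaSet_succ (by omega)]; rfl

/-- This makes `a ↦ a - #{x ∈ X | x < a}` monotone and, in the case of lower bound `0`, free of
truncation. -/
theorem card_filter_lt_add (X : BetaSet) (a b : ℕ) :
    (X.filter (· < b)).card ≤ (X.filter (· < a)).card + (b - a) := by
  have h : X.filter (· < b) ⊆ X.filter (· < a) ∪ Finset.Ico a b := by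
    intro c
    simp only [Finset.mem_filter, Finset.mem_union, Finset.mem_Ico]
    intro hc
    by_cases hca : c < a
    · exact Or.inl ⟨hc.1, hca⟩
    · exact Or.inr ⟨not_lt.1 hca, hc.2⟩
  calc _ ≤ _ := Finset.card_le_card h
    _ ≤ _ := Finset.card_union_le _ _
    _ = _ := by rw [Nat.card_Ico]

theorem card_filter_lt_getElem {l : List ℕ} (hl : l.SortedGT) {i : ℕ} (hi : i < l.length) :
    (l.toFinset.filter (· < l[i])).card = l.length - 1 - i := by
  induction l generalizing i with
  | nil => simp at hi
  | cons a l ih =>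
    have hp := List.pairwise_cons.1 hl.pairwise
    cases i with
    | zero =>
      have : (a :: l).toFinset.filter (· < a) = l.toFinset := by
        ext b
        simp only [Finset.mem_filter, List.mem_toFinset, List.mem_cons]
        constructor
        · rintro ⟨rfl | h, h'⟩
          · exact absurd h' (lt_irrefl _)
          · exact h
        · exact fun h => ⟨Or.inr h, hp.1 b h⟩
      simp only [List.getElem_cons_zero]
      rw [this, List.toFinset_card_of_nodup hp.2.sortedGT.nodup]
      simp
    | succ i =>
      have hi' : i < l.length := by simpa using hi
      have : (a :: l).toFinset.filter (· < l[i]) = l.toFinset.filter (· < l[i]) := by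
        rw [List.toFinset_cons, Finset.filter_insert,
          if_neg (not_lt.2 (hp.1 _ (List.getElem_mem hi')).le)]
      simp only [List.getElem_cons_succ]
      rw [this, ih hp.2.sortedGT hi']
      simp only [List.length_cons]
      omega

theorem betaSet_card_toPartition (X : BetaSet) : betaSet X.card (toPartition X) = X := by
  set L := X.sort (· ≥ ·) with hL
  have hLen : L.length = X.card := Finset.length_sort _
  have hLX : L.toFinset = X := Finset.sort_toFinset _ _
  have hgt : L.SortedGT := Finset.sortedGT_sort X
  set f : ℕ → ℕ := fun a => a - (X.filter (· < a)).card with hf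
  have hmono : Monotone f := by
    intro a b hab
    have := card_filter_lt_add X a b
    have h2 : (X.filter (· < a)).card ≤ a := by
      simpa using card_filter_lt_add X 0 a
    simp only [hf]
    omega
  have hpart : ∀ i, (toPartition X).part i = (L.map f).getD i 0 := by
    refine IntPartition.part_eq_getD ?_ ?_
    · refine (List.pairwise_map.2 (hgt.pairwise.imp fun h => ?_)).sortedGE
      exact hmono (le_of_lt h)
    · rw [← Multiset.map_coe, hL, Finset.sort_eq]
      rfl
  have hval : ∀ i (hi : i < L.length), (toPartition X).part i + (X.card - 1 - i) = L[i] := by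
    intro i hi
    have h1 := card_filter_lt_getElem hgt hi
    rw [hLX, hLen] at h1
    have h2 : (X.filter (· < L[i])).card ≤ L[i] := by
      simpa using card_filter_lt_add X 0 L[i]
    rw [hpart, List.getD_eq_getElem _ _ (by simpa using hi), List.getElem_map]
    simp only [hf]
    omega
  ext a
  rw [betaSet, Finset.mem_image]
  constructor
  · rintro ⟨i, hi, rfl⟩
    have hi' : i < L.length := hLen ▸ Finset.mem_range.1 hi
    rw [hval i hi', ← hLX]
    exact List.mem_toFinset.2 (List.getElem_mem hi')
  · intro ha
    rw [← hLX, List.mem_toFinset] at ha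
    obtain ⟨i, hi, rfl⟩ := List.getElem_of_mem ha
    exact ⟨i, Finset.mem_range.2 (hLen ▸ hi), hval i hi⟩

/-- The components of a symbol and of its balanced quotient agree after shifting both to a common
cardinality. -/
theorem shift_iterate_balancedQuotient {D : ℕ} (T : DSymbol D) : ∃ R r : ℕ,
    ∀ i, (T i).card ≤ R ∧ shift^[R - (T i).card] (T i) = shift^[r] (balancedQuotient T i) := by
  set r₀ := Finset.univ.sup fun m => (toPartition (T m)).length with hr₀
  set c := Finset.univ.sup fun m => (T m).card with hc
  -- The quotient uses size `r₀`; adding `c` makes the common size at least every `|T i|`.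
  refine ⟨r₀ + c, c, fun i => ?_⟩
  have h1 : (T i).card ≤ c := Finset.le_sup (f := fun m => (T m).card) (Finset.mem_univ i)
  have h2 : (toPartition (T i)).length ≤ r₀ :=
    Finset.le_sup (f := fun m => (toPartition (T m)).length) (Finset.mem_univ i)
  refine ⟨by omega, ?_⟩
  have h3 : balancedQuotient T i = betaSet r₀ (toPartition (T i)) := rfl
  rw [h3, ← betaSet_add h2]
  nth_rw 2 [← betaSet_card_toPartition (T i)]
  rw [← betaSet_add (length_toPartition_le _)]
  congr 1
  omega

/-! ### Counting hook lengths by pair sums. -/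

/-- The number `1` if `j < i`, and `0` otherwise: a hook from `i` to `j` satisfies `b < a + e`. -/
def shortBound {D : ℕ} (i j : Fin D) : ℕ := if j < i then 1 else 0

theorem shortBound_le_one {D : ℕ} (i j : Fin D) : shortBound i j ≤ 1 := by
  unfold shortBound; split_ifs <;> omega

theorem mem_hooks {D : ℕ} {T : DSymbol D} {a b : ℕ} {i j : Fin D} :
    (a, b, i, j) ∈ hooks T ↔ a ∈ T i ∧ b < a + shortBound i j ∧ b ∉ T j := by
  have h : (a, b, i, j) ∈ hooks T ↔ b ≤ a ∧ a ∈ T i ∧ b ∉ T j ∧ (a = b → j < i) := by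
    rw [hooks, Set.Finite.mem_toFinset]; rfl
  rw [h, shortBound]
  split_ifs with hij
  · simp only [hij, implies_true, Nat.lt_succ_iff]
    tauto
  · simp only [hij, add_zero, lt_iff_le_and_ne, ne_eq, eq_comm (a := a)]
    tauto

theorem sum_hooks {D : ℕ} (T : DSymbol D) (f : ℕ × ℕ × Fin D × Fin D → ℤ) :
    ∑ z ∈ hooks T, f z = ∑ i, ∑ j, ∑ a ∈ T i, ∑ b ∈ Finset.range (a + shortBound i j),
      if b ∈ T j then 0 else f (a, b, i, j) := by
  have h : ∀ i j a, (∑ b ∈ Finset.range (a + shortBound i j),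
      if b ∈ T j then 0 else f (a, b, i, j)) =
        ∑ b ∈ (Finset.range (a + shortBound i j)).filter (· ∉ T j), f (a, b, i, j) := by
    intro i j a
    rw [Finset.sum_filter]
    refine Finset.sum_congr rfl fun b _ => ?_
    rw [ite_not]
  simp only [h, Finset.sum_sigma']
  refine Finset.sum_nbij' (fun z => ⟨z.2.2.1, z.2.2.2, z.1, z.2.1⟩)
    (fun w => (w.2.2.1, w.2.2.2, w.1, w.2.1)) ?_ ?_ ?_ ?_ ?_
  · rintro ⟨a, b, i, j⟩ hz
    simpa using mem_hooks.1 hz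
  · rintro ⟨i, j, a, b⟩ hw
    exact mem_hooks.2 (by simpa using hw)
  · intros; rfl
  · intros; rfl
  · intros; rfl

/-- The indicator function of the event that a hook from `i` to `j` with `a - b = t` has
`δ`-length of absolute value `v`. -/
noncomputable def HookData.indicator {D : ℕ} (δ : HookData D) (v : ℝ) (i j : Fin D) (t : ℤ) : ℤ :=
  open Classical in if |δ.k * t + δ.c i - δ.c j| = v then 1 else 0

theorem HookData.indicator_neg {D : ℕ} (δ : HookData D) (v : ℝ) (i j : Fin D) (t : ℤ) :
    δ.indicator v i j (-t) = δ.indicator v j i t := by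
  rw [indicator, indicator, ← abs_neg]
  congr 3
  push_cast
  ring

theorem count_abs_hookLengths {D : ℕ} (δ : HookData D) (T : DSymbol D) (v : ℝ) :
    (((δ.hookLengths T).map fun x => |x|).count v : ℤ) =
      ∑ i, ∑ j, rowSum (T i) (T j) (shortBound i j) (δ.indicator v i j) := by
  classical
  rw [HookData.hookLengths, Multiset.map_map, Multiset.count_map, ← Finset.filter_val,
    Finset.card_val, Finset.card_filter, Nat.cast_sum, sum_hooks]
  refine Finset.sum_congr rfl fun i _ => Finset.sum_congr rfl fun j _ =>
    Finset.sum_congr rfl fun a _ => Finset.sum_congr rfl fun b _ => ?_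
  congr 1
  simp only [HookData.indicator, HookData.hookLength, Function.comp_apply, Nat.cast_ite,
    Nat.cast_one, Nat.cast_zero, eq_comm (a := v), Int.cast_sub, Int.cast_natCast]

/-- Reversing a pair negates its length, which the absolute value ignores, so summing over ordered
pairs `(i, j)` counts each hook twice. -/
theorem two_mul_count_abs_hookLengths {D : ℕ} (δ : HookData D) (T : DSymbol D) (v : ℝ) :
    2 * (((δ.hookLengths T).map fun x => |x|).count v : ℤ) =
      ∑ i, ∑ j, pairSum (T i) (T j) (shortBound i j) (δ.indicator v i j) := by
  have h : ∀ i j, rowSum (T j) (T i) (1 - shortBound i j) (fun t => δ.indicator v i j (-t)) =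
      rowSum (T j) (T i) (shortBound j i) (δ.indicator v j i) := by
    intro i j
    simp only [HookData.indicator_neg]
    rcases lt_trichotomy i j with hij | rfl | hij
    · simp [shortBound, hij, hij.not_gt]
    -- On the diagonal the bounds `1 - e` and `e` differ, but `rowSum_self` makes this harmless.
    · simp [shortBound, rowSum_self]
    · simp [shortBound, hij, hij.not_gt]
  simp only [pairSum, h, Finset.sum_add_distrib]
  rw [Finset.sum_comm (f := fun i j => rowSum (T j) (T i) (shortBound j i) (δ.indicator v j i)),
    ← count_abs_hookLengths, two_mul]

/-- The absolute hook lengths of a symbol are those of its balanced quotient, for the data adjusted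
by the cardinalities of the components, together with those of its core. -/
theorem abs_hookLengths_eq_balancedQuotient_add_core {D : ℕ} (T : DSymbol D) (δ δ' : HookData D)
    (hk : δ'.k = δ.k) (hc : ∀ i, δ'.c i = δ.c i + (T i).card * δ.k) :
    (δ.hookLengths T).map (fun x => |x|) =
      (δ'.hookLengths (balancedQuotient T)).map (fun x => |x|) +
        (δ.hookLengths (core T)).map (fun x => |x|) := by
  classical
  obtain ⟨R, r, hR⟩ := shift_iterate_balancedQuotient T
  ext v
  rw [Multiset.count_add]
  have key : ∀ i j, pairSum (T i) (T j) (shortBound i j) (δ.indicator v i j) =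
      pairSum (balancedQuotient T i) (balancedQuotient T j) (shortBound i j)
          (δ'.indicator v i j) +
        pairSum (core T i) (core T j) (shortBound i j) (δ.indicator v i j) := by
    intro i j
    have he := shortBound_le_one i j
    -- The net translation is `|T i| - |T j|`; multiplied by `k` it is exactly the change from `δ`
    -- to `δ'`.
    have hg : (fun t : ℤ => δ.indicator v i j
        (t - (R - (T i).card : ℕ) + (R - (T j).card : ℕ))) = δ'.indicator v i j := by
      funext t
      unfold HookData.indicator
      congr 3
      rw [hk, hc, hc]
      push_cast [(hR i).1, (hR j).1]
      ring
    have hcard : ∀ i, (T i).card = (core T i).card := fun i => (Finset.card_range _).symm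
    have hcore : ∀ i, shift^[R - (T i).card] (core T i) = Finset.range R := by
      intro i
      rw [core, shift_iterate_range, Nat.add_sub_cancel' (hR i).1]
    have h := pairSum_shift_iterate (hcard i) (hcard j) he (δ.indicator v i j)
      (R - (T i).card) (R - (T j).card)
    rw [hg, (hR i).2, (hR j).2, hcore, hcore, pairSum_range _ he,
      pairSum_shift_shift_iterate _ _ he] at h
    linarith
  have h : 2 * (((δ.hookLengths T).map fun x => |x|).count v : ℤ) =
      2 * (((δ'.hookLengths (balancedQuotient T)).map fun x => |x|).count v : ℤ) +
        2 * (((δ.hookLengths (core T)).map fun x => |x|).count v : ℤ) := by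
    simp only [two_mul_count_abs_hookLengths, key, Finset.sum_add_distrib]
  omega

/-! ### Comparing a symbol with its splitting. -/

theorem mem_symbolEquiv {d : ℕ} [NeZero d] {X : BetaSet} {j : Fin d} {k : ℕ} :
    k ∈ symbolEquiv d X j ↔ (j : ℕ) + k * d ∈ X :=
  Finset.mem_preimage (hf := (residueClass_injective j).injOn)

/-- The order of the numbers `i + a d` is lexicographic in `(a, i)`; the convention on short hooks
is its tie-break. -/
theorem mem_hooks_symbolEquiv {d : ℕ} [NeZero d] {X : BetaSet} {a b : ℕ} {i j : Fin d} :
    (a, b, i, j) ∈ hooks (symbolEquiv d X) ↔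
      (i : ℕ) + a * d ∈ X ∧ (j : ℕ) + b * d < i + a * d ∧ (j : ℕ) + b * d ∉ X := by
  rw [mem_hooks, mem_symbolEquiv, mem_symbolEquiv]
  have : b < a + shortBound i j ↔ (j : ℕ) + b * d < i + a * d := by
    have hi := i.2
    have hj := j.2
    rcases lt_trichotomy a b with h | rfl | h
    · have : (a + 1) * d ≤ b * d := Nat.mul_le_mul_right d h
      have := shortBound_le_one i j
      rw [add_mul] at *
      constructor <;> intro <;> omega
    · unfold shortBound
      split_ifs with hij <;> rw [Fin.lt_def] at hij <;> omega
    · have : (b + 1) * d ≤ a * d := Nat.mul_le_mul_right d h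
      rw [add_mul] at *
      constructor <;> intro <;> omega
  rw [this]

/-- The hooks of a `β`-set: the pairs `(A, B)` with `A ∈ X`, `B ∉ X` and `B < A`. -/
def betaHooks (X : BetaSet) : Finset (Σ _ : ℕ, ℕ) :=
  X.sigma fun A => (Finset.range A).filter (· ∉ X)

/-- The residue of a natural number modulo `d`. -/
def residue (d : ℕ) [NeZero d] (A : ℕ) : Fin d := ⟨A % d, Nat.mod_lt _ (NeZero.pos d)⟩

theorem HookData.hookLengths_symbolEquiv {d : ℕ} [NeZero d] (δ : HookData d) (X : BetaSet) :
    δ.hookLengths (symbolEquiv d X) = (betaHooks X).val.map fun z =>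
      δ.hookLength (z.1 / d, z.2 / d, residue d z.1, residue d z.2) := by
  symm
  refine Multiset.map_eq_map_of_bij_of_nodup _ _ (betaHooks X).nodup (hooks _).nodup
    (fun z _ => (z.1 / d, z.2 / d, residue d z.1, residue d z.2)) ?_ ?_ ?_ (fun _ _ => rfl)
  · rintro ⟨A, B⟩ h
    rw [Finset.mem_val, mem_hooks_symbolEquiv]
    simpa [residue, Nat.mod_add_div', betaHooks] using h
  · rintro ⟨A, B⟩ _ ⟨A', B'⟩ _ h
    simp only [residue, Prod.mk.injEq, Fin.mk.injEq] at h
    obtain ⟨h1, h2, h3, h4⟩ := h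
    have hA : A = A' := by rw [← Nat.mod_add_div' A d, h1, h3, Nat.mod_add_div']
    have hB : B = B' := by rw [← Nat.mod_add_div' B d, h2, h4, Nat.mod_add_div']
    rw [hA, hB]
  · rintro ⟨a, b, i, j⟩ h
    have h := mem_hooks_symbolEquiv.1 h
    refine ⟨⟨i + a * d, j + b * d⟩, ?_, ?_⟩
    · simpa [betaHooks] using h
    · simp [residue, Nat.add_mul_div_right _ _ (NeZero.pos d), Nat.div_eq_of_lt,
        Nat.mod_eq_of_lt]

/-- The hook data tuple whose lengths on `splitSymbol ℓ S` are the hook lengths of `S`. -/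
noncomputable def splitData (d ℓ : ℕ) : HookData (d * ℓ) where
  c := fun m => ((m : ℕ) / d : ℕ)
  k := ℓ
  k_nonneg := Nat.cast_nonneg ℓ

/-- Both sides are indexed by the hooks `(A, B)` of one β-set, with length `⌊A/d⌋ - ⌊B/d⌋`; on the
right, `⌊A/d⌋` is divided by `ℓ` with remainder. -/
theorem hookLengths_eq_splitSymbol {d ℓ : ℕ} [NeZero d] [NeZero ℓ] (S : DSymbol d) :
    hookLengths S = (splitData d ℓ).hookLengths (splitSymbol ℓ S) := by
  have hS : S = symbolEquiv d ((symbolEquiv d).symm S) := (Equiv.apply_symm_apply _ _).symm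
  rw [splitSymbol, HookData.hookLengths_symbolEquiv]
  nth_rw 1 [hS]
  rw [hookLengths, HookData.hookLengths_symbolEquiv]
  refine Multiset.map_congr rfl fun z _ => ?_
  have h : ∀ A : ℕ, ((A / d : ℕ) : ℝ) =
      (ℓ : ℝ) * ((A / (d * ℓ) : ℕ) : ℝ) + ((A % (d * ℓ) / d : ℕ) : ℝ) := by
    intro A
    rw [Nat.mod_mul_right_div_self, ← Nat.div_div_eq_div_mul]
    exact_mod_cast (Nat.div_add_mod (A / d) ℓ).symm
  simp only [HookData.hookLength, minimalData, splitData, residue]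
  rw [h z.1, h z.2]
  ring

theorem abs_hookLengths {d : ℕ} (S : DSymbol d) :
    (hookLengths S).map (fun x => |x|) = hookLengths S := by
  conv_rhs => rw [← Multiset.map_id (hookLengths S)]
  refine Multiset.map_congr rfl fun x hx => abs_of_nonneg ?_
  obtain ⟨⟨a, b, i, j⟩, hz, rfl⟩ := Multiset.mem_map.1 hx
  have hba : b ≤ a := ((hookSet_finite S).mem_toFinset.1 hz).1
  have : (b : ℝ) ≤ a := Nat.cast_le.2 hba
  simp only [HookData.hookLength, minimalData]
  linarith

/-- For `m = s d + i`, the map `k ↦ s + k ℓ` carries component `m` onto the elements of `S i`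
congruent to `s`. Thus `lData` is `splitData` adjusted by cardinalities. -/
theorem residueCount_eq_card_splitSymbol {d ℓ : ℕ} [NeZero d] [NeZero ℓ] (S : DSymbol d)
    (m : Fin (d * ℓ)) :
    residueCount ℓ (S (residue d m)) ((m : ℕ) / d) = (splitSymbol ℓ S m).card := by
  have hlt : (m : ℕ) / d < ℓ := Nat.div_lt_of_lt_mul m.2
  have hmem : ∀ k, k ∈ splitSymbol ℓ S m ↔ (m : ℕ) / d + k * ℓ ∈ S (residue d m) := by
    intro k
    obtain ⟨X, rfl⟩ := (symbolEquiv d).surjective S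
    rw [splitSymbol, Equiv.symm_apply_apply, mem_symbolEquiv, mem_symbolEquiv]
    have : (residue d m : ℕ) + ((m : ℕ) / d + k * ℓ) * d = m + k * (d * ℓ) := by
      conv_rhs => rw [← Nat.mod_add_div' (m : ℕ) d]
      simp only [residue]
      ring
    rw [this]
  have himage : (S (residue d m)).filter (fun a => a ≡ (m : ℕ) / d [MOD ℓ]) =
      (splitSymbol ℓ S m).image fun k => (m : ℕ) / d + k * ℓ := by
    ext a
    simp only [Finset.mem_filter, Finset.mem_image, hmem]
    constructor
    · rintro ⟨ha, h⟩
      have h' : a % ℓ = (m : ℕ) / d := by rw [h, Nat.mod_eq_of_lt hlt]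
      have : (m : ℕ) / d + a / ℓ * ℓ = a := by rw [← h', Nat.mod_add_div']
      exact ⟨a / ℓ, by rwa [this], this⟩
    · rintro ⟨k, hk, rfl⟩
      exact ⟨hk, by simp [Nat.ModEq]⟩
  rw [residueCount, himage, Finset.card_image_of_injective]
  exact fun _ _ h => Nat.eq_of_mul_eq_mul_right (NeZero.pos ℓ) (Nat.add_left_cancel h)

theorem splitSymbol_lCore {d ℓ : ℕ} [NeZero d] [NeZero ℓ] (S : DSymbol d) :
    splitSymbol ℓ (lCore ℓ S) = core (splitSymbol ℓ S) := by
  rw [splitSymbol, lCore, Equiv.symm_apply_apply, Equiv.apply_symm_apply]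

end HookSymbols

theorem theorem5p2 (d ℓ : ℕ) [NeZero d] [NeZero ℓ] (S : HookSymbols.DSymbol d) :
    HookSymbols.hookLengths S =
      ((HookSymbols.lData ℓ S).hookLengths (HookSymbols.lQuotient ℓ S)).map (fun x => |x|) +
        HookSymbols.hookLengths (HookSymbols.lCore ℓ S) := by
  rw [← HookSymbols.abs_hookLengths S, ← HookSymbols.abs_hookLengths (HookSymbols.lCore ℓ S),
    HookSymbols.hookLengths_eq_splitSymbol (ℓ := ℓ) S,
    HookSymbols.hookLengths_eq_splitSymbol (ℓ := ℓ) (HookSymbols.lCore ℓ S),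
    HookSymbols.splitSymbol_lCore]
  refine HookSymbols.abs_hookLengths_eq_balancedQuotient_add_core _ _ _ rfl fun m => ?_
  rw [← HookSymbols.residueCount_eq_card_splitSymbol]
  rfl
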